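/- Notation. Let $G$ be an Abelian group, written additively, and let $n\ge 0$. A function $P:\{0,1\}^n\to G$ is a polynomial of degree at most $d$ if there are $\alpha_I\in G$ with $P(x)=\sum_{I\subseteq[n],\,|I|\le d}\bigl(\prod_{i\in I}x_i\bigr)\alpha_I$ for all $x\in\{0,1\}^n$ (the products $\prod_{i\in I}x_i$ are integers); $\mathcal P_d(\{0,1\}^n,G)$ is the set of these functions. For $f,g:\{0,1\}^n\to G$ let $\delta(f,g)$ be the fraction of points $x\in\{0,1\}^n$ with $f(x)\ne g(x)$. For $f:\{0,1\}^n\to G$ and $\varepsilon>0$ let $$\mathsf{List}^f_\varepsilon=\{P\in\mathcal P_d(\{0,1\}^n,G):\ \delta(f,P)\le 2^{-d}-\varepsilon\}.$$ For real $\delta$ and $L$, $\mathcal P_d(\{0,1\}^n,G)$ is $(\delta,L)$-list-decodable if for every $f:\{0,1\}^n\to G$ the set of $P\in\mathcal P_d(\{0,1\}^n,G)$ with $\delta(f,P)\le\delta$ is finite with at most $L$ elements. A $p$-group is a group in which the order of every element is a power of the prime $p$. Theorem. (1) There is an absolute constant $C\in\mathbb N$ such that for all $d\ge 1$ and $p_0$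 there is $A=A(d,p_0)>0$ with the following property. Let $G$ be (isomorphic to) a product of finitely many Abelian $p$-groups, where every prime $p$ that occurs is at most $p_0$. Then for all $\varepsilon>0$, all $n$, and all $f:\{0,1\}^n\to G$, the set $\mathsf{List}^f_\varepsilon$ is finite and $$|\mathsf{List}^f_\varepsilon|\le\exp\bigl((A/\varepsilon)^{Cd}\bigr).$$ In particular, if $p_0=2^{2^{Kd^2}}$ with a fixed constant $K$, then $A$ depends only on $d$ and $K$, and the bound is $\exp(O_d(1/\varepsilon)^{O(d)})$. (2) There is an absolute constant $C\in\mathbb N$ such that for all $d\ge 1$ and all primes $p$ there is $A=A(d,p)>0$ such that for all $\varepsilon>0$, all $n$ and all $f:\{0,1\}^n\to\mathbb Z_p$, the set $\mathsf{List}^f_\varepsilon$ has at most $\exp\bigl((A/\varepsilon)^{Cd}\bigr)$ elements. (3) For every $d\ge 1$ there is a constant $C=C(d)>0$ such that the following holds for all $\varepsilon>0$ and all $n$. Let $\mathcal S$ be a set of primes and $L\ge 1$ an integer such that $\mathcal P_d(\{0,1\}^n,\mathbb Z_p)$ is $(2^{-d}-\varepsilon,L)$-list-decodable for every $p\in\mathcal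 S$. Then for every Abelian group $G$ that is (isomorphic to) a product of finitely many $p$-groups with $p\in\mathcal S$, $\mathcal P_d(\{0,1\}^n,G)$ is $(2^{-d}-\varepsilon,\,L^{C\log(1/\varepsilon)})$-list-decodable. -/

import Mathlib

universe u

/-- The space of polynomial functions `{0,1}^n → G` of degree at most `d`: the functions of the form
`x ↦ ∑_{I ⊆ [n], |I| ≤ d} (∏_{i ∈ I} x_i) • α_I` with coefficients `α_I` in the Abelian group `G`,
the products being taken over the integers. The cube `{0,1}^n` is `Fin n → Bool`. -/
def degreePolys (d n : ℕ) (G : Type u) [AddCommGroup G] : Set ((Fin n → Bool) → G) :=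
  {P | ∃ α : Finset (Fin n) → G, ∀ x : Fin n → Bool,
    P x = ∑ I : Finset (Fin n) with I.card ≤ d, (∏ i ∈ I, (x i).toNat) • α I}

open Classical in
/-- The fractional Hamming distance `δ(f, g)`: the fraction of points of `{0,1}^n` at which
`f` and `g` differ. -/
noncomputable def fracDist {n : ℕ} {G : Type u} (f g : (Fin n → Bool) → G) : ℝ :=
  (hammingDist f g : ℝ) / 2 ^ n

/-- The members of the family `F` that are `δ`-close to `f`. -/
def closeList {n : ℕ} {G : Type u} (F : Set ((Fin n → Bool) → G)) (δ : ℝ)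
    (f : (Fin n → Bool) → G) : Set ((Fin n → Bool) → G) :=
  {P | P ∈ F ∧ fracDist f P ≤ δ}

/-- The family `F` is `(δ, L)`-list-decodable: for every `f`, at most `L` members of `F`
(in particular finitely many) are `δ`-close to `f`. -/
def IsListDecodable {n : ℕ} {G : Type u} (F : Set ((Fin n → Bool) → G)) (δ L : ℝ) : Prop :=
  ∀ f : (Fin n → Bool) → G, (closeList F δ f).Finite ∧ ((closeList F δ f).ncard : ℝ) ≤ L

/-- `G` is (isomorphic to) a product of finitely many Abelian `p`-groups, each for some prime `p`
in the set `S`. The factors are allowed to be infinite. -/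
def IsProductOfPGroups (S : Set ℕ) (G : Type u) [AddCommGroup G] : Prop :=
  ∃ (m : ℕ) (p : Fin m → ℕ) (H : Fin m → Type u) (_ : ∀ i, AddCommGroup (H i)),
    (∀ i, (p i).Prime ∧ p i ∈ S ∧ IsPGroup (p i) (Multiplicative (H i))) ∧
    Nonempty (G ≃+ (∀ i, H i))

/-!
The proof has two independent parts.

**Lists over a fixed finite group.** For distinct coordinates `i, j` and a sign `s`, the half-cube
`{x | x_i ⊕ x_j = s}` is a cube of one dimension less, on which polynomials of degree at most `d`
restrict to polynomials of degree at most `d`. A polynomial that vanishes on one half and is not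
zero is nonzero on at least a `2^{1-d}` fraction of the other half, by the distance lemma. Hence a
polynomial `P` is determined by its restriction to one half among the polynomials whose error (the
density of `{f ≠ P}`) on the other half is less than `2⁻ᵈ` (`eq_of_eqOn_half`). The error of `P`
on the half `(i, j, s)` differs from its error on the whole cube by `±` the Fourier coefficient of
`{f ≠ P}` at `{i, j}`. By Bessel's inequality the squares of these coefficients sum to at most one,
so on average over the `~ n² / 2` pairs the square of the change is `O(n⁻²)`. As `∑ n⁻²` converges,
the positive part of `2⁻ᵈ - error - O(1 / √k)`, summed over all `P`, does not decrease on average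
when the cube is halved repeatedly from dimension `n` down to dimension `k`
(`le_sum_half_potential`, `sum_potential_le`). In dimension `k` it is at most the number of all polynomials, which is at most
`|G| ^ (k + 1) ^ d`. With `k ~ 16 / ε²` this bounds the list (`isListDecodable_of_finite`).

**Lifting from prime fields.** Let `excess D` be the amount by which the density of a set `D`
exceeds `1 - 2⁻ᵈ`. If `K` is a finite group, map it nontrivially to some `ℤ_q`. The members of a
list over `K`, for a function on the domain `D`, are grouped by their images; there are at most `L`
images `u`, and the members of one group differ by polynomials over the kernel and agree with `f`
only inside the set `D_u` where the image of `f` is `u`. Two distinct images agree on a set of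
density at most `1 - 2⁻ᵈ`, so `excess D_u + excess D_v ≤ excess D` (`excess_add_le`). All excesses
in the resulting tree are at least `ε`, and the elementary inequality `sum_pow_le_pow` turns this
into the bound `(excess D / ε) ^ a` with `2 ^ a ≥ L` on the list (`card_le_excess_pow`). An infinite
group is replaced by the finite subgroup that the values of finitely many members generate.

The bound for products of `p`-groups with `p ≤ p₀` combines the two parts.
-/

/-! ### Polynomials on the cube -/

/-- The polynomials of degree at most `d` on the cube, as a subgroup of all functions. -/
def degreePolysSubgroup (d n : ℕ) (G : Type*) [AddCommGroup G] :
    AddSubgroup ((Fin n → Bool) → G) where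
  carrier := degreePolys d n G
  zero_mem' := ⟨0, by simp⟩
  add_mem' := by
    rintro P Q ⟨α, hα⟩ ⟨β, hβ⟩
    exact ⟨α + β, fun x => by simp [hα, hβ, Finset.sum_add_distrib]⟩
  neg_mem' := by
    rintro P ⟨α, hα⟩
    exact ⟨-α, fun x => by simp [hα]⟩

section Polynomials

variable {d n m : ℕ} {G H : Type*} [AddCommGroup G] [AddCommGroup H]

@[simp] lemma mem_degreePolysSubgroup {P : (Fin n → Bool) → G} :
    P ∈ degreePolysSubgroup d n G ↔ P ∈ degreePolys d n G := Iff.rfl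

lemma sub_mem_degreePolys {P Q : (Fin n → Bool) → G} (hP : P ∈ degreePolys d n G)
    (hQ : Q ∈ degreePolys d n G) : P - Q ∈ degreePolys d n G :=
  (degreePolysSubgroup d n G).sub_mem hP hQ

lemma monomial_mem_degreePolys (I : Finset (Fin n)) (hI : I.card ≤ d) (a : G) :
    (fun x : Fin n → Bool => (∏ i ∈ I, (x i).toNat) • a) ∈ degreePolys d n G := by
  classical
  refine ⟨Pi.single I a, fun x => ?_⟩
  rw [Finset.sum_eq_single I]
  · simp
  · intro J _ hJ
    simp [Pi.single_eq_of_ne hJ]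
  · intro h
    simp [hI] at h

lemma const_mem_degreePolys (a : G) : (fun _ : Fin n → Bool => a) ∈ degreePolys d n G := by
  simpa using monomial_mem_degreePolys (n := n) (d := d) ∅ (by simp) a

/-- Induction on monomials: a subgroup of functions that contains the monomials of degree at most `d`
contains all polynomials of degree at most `d`. -/
lemma degreePolys_subset_of_monomials (A : AddSubgroup ((Fin n → Bool) → G))
    (h : ∀ I : Finset (Fin n), I.card ≤ d → ∀ a : G,
      (fun x : Fin n → Bool => (∏ i ∈ I, (x i).toNat) • a) ∈ A)
    {P : (Fin n → Bool) → G} (hP : P ∈ degreePolys d n G) : P ∈ A := by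
  obtain ⟨α, hα⟩ := hP
  have : P = ∑ I : Finset (Fin n) with I.card ≤ d,
      fun x : Fin n → Bool => (∏ i ∈ I, (x i).toNat) • α I := by
    ext x
    simp [hα]
  rw [this]
  exact A.sum_mem fun I hI => h I (by simpa using hI) _

lemma degreePolys_mono {e : ℕ} (h : d ≤ e) {P : (Fin n → Bool) → G}
    (hP : P ∈ degreePolys d n G) : P ∈ degreePolys e n G :=
  degreePolys_subset_of_monomials (degreePolysSubgroup e n G)
    (fun I hI a => monomial_mem_degreePolys I (hI.trans h) a) hP

lemma coord_smul_mem_degreePolys (k : Fin n) {P : (Fin n → Bool) → G}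
    (hP : P ∈ degreePolys d n G) :
    (fun x => (x k).toNat • P x) ∈ degreePolys (d + 1) n G := by
  classical
  let φ : ((Fin n → Bool) → G) →+ ((Fin n → Bool) → G) :=
    { toFun := fun P x => (x k).toNat • P x
      map_zero' := by ext; simp
      map_add' := by intros; ext; simp }
  refine degreePolys_subset_of_monomials ((degreePolysSubgroup (d + 1) n G).comap φ)
    (fun I hI a => ?_) hP
  change (fun x : Fin n → Bool => (x k).toNat • (∏ i ∈ I, (x i).toNat) • a) ∈ degreePolys _ _ _
  convert monomial_mem_degreePolys (insert k I)
    ((Finset.card_insert_le _ _).trans (Nat.succ_le_succ hI)) a using 2 with x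
  by_cases hk : k ∈ I
  · rw [Finset.insert_eq_of_mem hk, smul_smul]
    cases hx : x k
    · simp [Finset.prod_eq_zero (f := fun i => (x i).toNat) hk (by simp [hx])]
    · simp
  · rw [Finset.prod_insert hk, smul_smul]

/-- A map between cubes each of whose output bits is a constant or a literal. -/
def IsLiteralMap (e : (Fin n → Bool) → (Fin m → Bool)) : Prop :=
  ∀ i, (∃ b, ∀ y, e y i = b) ∨ ∃ k b, ∀ y, e y i = (b ^^ y k)

lemma IsLiteralMap.monomial_comp_mem {e : (Fin n → Bool) → (Fin m → Bool)} (he : IsLiteralMap e)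
    (I : Finset (Fin m)) (a : G) :
    (fun y => (∏ i ∈ I, (e y i).toNat) • a) ∈ degreePolys I.card n G := by
  classical
  induction I using Finset.induction_on with
  | empty => simpa using const_mem_degreePolys a
  | insert i I hi ih =>
    simp only [Finset.prod_insert hi, Finset.card_insert_of_notMem hi, mul_smul]
    rcases he i with ⟨b, hb⟩ | ⟨k, b, hb⟩
    · cases b
      · simpa [hb] using const_mem_degreePolys (0 : G)
      · simpa [hb] using degreePolys_mono (Nat.le_succ _) ih
    · cases b
      · simpa [hb] using coord_smul_mem_degreePolys k ih
      · convert sub_mem_degreePolys (degreePolys_mono (Nat.le_succ _) ih)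
          (coord_smul_mem_degreePolys k ih) using 2 with y
        cases hy : y k <;> simp [hb, hy]

lemma IsLiteralMap.comp_mem {e : (Fin n → Bool) → (Fin m → Bool)} (he : IsLiteralMap e)
    {P : (Fin m → Bool) → G} (hP : P ∈ degreePolys d m G) :
    P ∘ e ∈ degreePolys d n G := by
  let φ : ((Fin m → Bool) → G) →+ ((Fin n → Bool) → G) :=
    { toFun := fun P => P ∘ e
      map_zero' := rfl
      map_add' := fun _ _ => rfl }
  exact degreePolys_subset_of_monomials ((degreePolysSubgroup d n G).comap φ)
    (fun I hI a => degreePolys_mono hI (he.monomial_comp_mem I a)) hP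

lemma isLiteralMap_cons (b : Bool) :
    IsLiteralMap (fun y : Fin n → Bool => (Fin.cons b y : Fin (n + 1) → Bool)) := by
  intro i
  refine Fin.cases (Or.inl ⟨b, fun y => by simp⟩) (fun k => Or.inr ⟨k, false, fun y => by simp⟩) i

lemma isLiteralMap_tail : IsLiteralMap (fun x : Fin (n + 1) → Bool => Fin.tail x) :=
  fun k => Or.inr ⟨k.succ, false, fun y => by simp [Fin.tail]⟩

/-- The discrete derivative in the first coordinate lowers the degree. -/
lemma derivative_mem_degreePolys {P : (Fin (n + 1) → Bool) → G}
    (hP : P ∈ degreePolys (d + 1) (n + 1) G) :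
    (fun y => P (Fin.cons true y) - P (Fin.cons false y)) ∈ degreePolys d n G := by
  classical
  let φ : ((Fin (n + 1) → Bool) → G) →+ ((Fin n → Bool) → G) :=
    { toFun := fun P y => P (Fin.cons true y) - P (Fin.cons false y)
      map_zero' := by ext; simp
      map_add' := by intros; ext; simp; abel }
  refine degreePolys_subset_of_monomials ((degreePolysSubgroup d n G).comap φ)
    (fun I hI a => ?_) hP
  change (fun y : Fin n → Bool =>
    (∏ i ∈ I, ((Fin.cons true y : Fin (n + 1) → Bool) i).toNat) • a -
    (∏ i ∈ I, ((Fin.cons false y : Fin (n + 1) → Bool) i).toNat) • a) ∈ degreePolys d n G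
  by_cases h0 : (0 : Fin (n + 1)) ∈ I
  · refine degreePolys_mono (d := (I.erase 0).card) ?_ ?_
    · rw [Finset.card_erase_of_mem h0]; omega
    · convert (isLiteralMap_cons true).monomial_comp_mem (I.erase 0) a using 2 with y
      rw [← Finset.mul_prod_erase I _ h0, ← Finset.mul_prod_erase I _ h0]
      simp
  · convert const_mem_degreePolys (0 : G) using 2 with y
    rw [sub_eq_zero]
    congr 1
    refine Finset.prod_congr rfl fun i hi => ?_
    obtain ⟨k, rfl⟩ := Fin.exists_succ_eq.2 (fun h => h0 (h ▸ hi) : i ≠ 0)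
    simp

lemma mem_degreePolys_zero {P : (Fin n → Bool) → G} :
    P ∈ degreePolys 0 n G ↔ ∃ a, ∀ x, P x = a := by
  constructor
  · rintro ⟨α, hα⟩
    refine ⟨α ∅, fun x => ?_⟩
    have : (Finset.univ.filter fun I : Finset (Fin n) => I.card ≤ 0) = {∅} := by ext; simp
    rw [hα, this]
    simp
  · rintro ⟨a, ha⟩
    rw [show P = fun _ => a from funext ha]
    exact const_mem_degreePolys a

/-- Splitting off the first coordinate: `P = P₀ + x₀ P₁` with `P₀` of degree at most `d + 1` and
`P₁` of degree at most `d`. -/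
lemma mem_degreePolys_succ {P : (Fin (n + 1) → Bool) → G} :
    P ∈ degreePolys (d + 1) (n + 1) G ↔
      (fun y => P (Fin.cons false y)) ∈ degreePolys (d + 1) n G ∧
      (fun y => P (Fin.cons true y) - P (Fin.cons false y)) ∈ degreePolys d n G := by
  refine ⟨fun h => ⟨(isLiteralMap_cons false).comp_mem h, derivative_mem_degreePolys h⟩, ?_⟩
  rintro ⟨h0, h1⟩
  have := (degreePolysSubgroup (d + 1) (n + 1) G).add_mem (isLiteralMap_tail.comp_mem h0)
    (coord_smul_mem_degreePolys 0 (isLiteralMap_tail.comp_mem h1))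
  rw [mem_degreePolysSubgroup] at this
  convert this using 1
  ext x
  have hx : x = Fin.cons (x 0) (Fin.tail x) := (Fin.cons_self_tail x).symm
  cases h : x 0 <;> rw [h] at hx <;> simp [h, ← hx]

lemma mem_degreePolys_of_dim_zero (P : (Fin 0 → Bool) → G) : P ∈ degreePolys d 0 G := by
  rw [show P = fun _ => P 0 from funext fun x => congrArg P (Subsingleton.elim _ _)]
  exact const_mem_degreePolys _

lemma AddMonoidHom.comp_mem_degreePolys (φ : G →+ H) {P : (Fin n → Bool) → G}
    (hP : P ∈ degreePolys d n G) : φ ∘ P ∈ degreePolys d n H := by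
  obtain ⟨α, hα⟩ := hP
  exact ⟨φ ∘ α, fun x => by simp [hα]⟩

/-- A polynomial with values in a subgroup has its coefficients there; the subgroup is given by an
injective homomorphism. -/
lemma mem_degreePolys_of_injective (φ : G →+ H) (hφ : Function.Injective φ)
    {P : (Fin n → Bool) → G} (hP : φ ∘ P ∈ degreePolys d n H) : P ∈ degreePolys d n G := by
  induction n generalizing d with
  | zero => exact mem_degreePolys_of_dim_zero P
  | succ n ih =>
    cases d with
    | zero =>
      obtain ⟨a, ha⟩ := mem_degreePolys_zero.1 hP
      exact mem_degreePolys_zero.2 ⟨P 0, fun x => hφ ((ha x).trans (ha 0).symm)⟩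
    | succ d =>
      obtain ⟨h0, h1⟩ := mem_degreePolys_succ.1 hP
      refine mem_degreePolys_succ.2 ⟨ih h0, ih ?_⟩
      convert h1 using 2 with y
      simp

lemma card_filter_cons (p : (Fin (n + 1) → Bool) → Prop) [DecidablePred p] :
    (Finset.univ.filter p).card =
      (Finset.univ.filter fun y : Fin n → Bool => p (Fin.cons false y)).card +
      (Finset.univ.filter fun y : Fin n → Bool => p (Fin.cons true y)).card := by
  classical
  have h : ∀ b : Bool, (Finset.univ.filter fun y : Fin n → Bool => p (Fin.cons b y)).card =
      ((Finset.univ.filter p).filter fun x => x 0 = b).card := by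
    intro b
    refine Finset.card_bij (fun y _ => Fin.cons b y) ?_ ?_ ?_
    · simp
    · intro y _ z _ h
      exact Fin.cons_right_injective (α := fun _ => Bool) b h
    · intro x hx
      simp only [Finset.mem_filter, Finset.mem_univ, true_and] at hx
      have hx' : (Fin.cons b (Fin.tail x) : Fin (n + 1) → Bool) = x := by
        rw [← hx.2]; exact Fin.cons_self_tail x
      exact ⟨Fin.tail x, by simpa [hx'] using hx.1, hx'⟩
  rw [h, h, ← Finset.card_filter_add_card_filter_not (s := Finset.univ.filter p)
    (fun x => x 0 = false)]
  simp

open Classical in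
/-- The distance lemma: a nonzero polynomial of degree at most `d` is nonzero on at least a
`2⁻ᵈ` fraction of the cube. -/
lemma two_pow_le_card_support {P : (Fin n → Bool) → G} (hP : P ∈ degreePolys d n G)
    (h0 : P ≠ 0) : 2 ^ n ≤ 2 ^ d * (Finset.univ.filter fun x => P x ≠ 0).card := by
  induction n generalizing d with
  | zero =>
    obtain ⟨x, hx⟩ := Function.ne_iff.1 h0
    have : 0 < (Finset.univ.filter fun x => P x ≠ 0).card :=
      Finset.card_pos.2 ⟨x, Finset.mem_filter.2 ⟨Finset.mem_univ x, hx⟩⟩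
    exact Nat.mul_pos (pow_pos two_pos d) this
  | succ n ih =>
    cases d with
    | zero =>
      obtain ⟨a, ha⟩ := mem_degreePolys_zero.1 hP
      have ha0 : a ≠ 0 := by
        rintro rfl
        exact h0 (funext ha)
      simp [ha, ha0]
    | succ d =>
      obtain ⟨hf, hd⟩ := mem_degreePolys_succ.1 hP
      have ht : (fun y => P (Fin.cons true y)) ∈ degreePolys (d + 1) n G :=
        (isLiteralMap_cons true).comp_mem hP
      rw [card_filter_cons, pow_succ 2 n]
      by_cases hf0 : (fun y => P (Fin.cons false y)) = 0
      · have hf0' : ∀ y, P (Fin.cons false y) = 0 := congrFun hf0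
        have := ih (P := fun y => P (Fin.cons true y)) (by simpa [hf0'] using hd) (by
          intro ht0
          refine h0 (funext fun x => ?_)
          rw [← Fin.cons_self_tail x]
          cases x 0
          · exact hf0' _
          · exact congrFun ht0 _)
        refine (Nat.mul_le_mul_right 2 this).trans ?_
        rw [pow_succ 2 d, mul_right_comm]
        exact Nat.mul_le_mul_left _ (Nat.le_add_left _ _)
      · have h1 := ih hf hf0
        by_cases ht0 : (fun y => P (Fin.cons true y)) = 0
        · have ht0' : ∀ y, P (Fin.cons true y) = 0 := congrFun ht0
          have := ih (P := fun y => P (Fin.cons false y))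
            (by simpa [ht0', Pi.neg_def] using (degreePolysSubgroup d n G).neg_mem hd) hf0
          refine (Nat.mul_le_mul_right 2 this).trans ?_
          rw [pow_succ 2 d, mul_right_comm]
          exact Nat.mul_le_mul_left _ (Nat.le_add_right _ _)
        · have h2 := ih ht ht0
          nlinarith

open Classical in
/-- Distinct polynomials of degree at most `d` differ on at least a `2⁻ᵈ` fraction of the cube. -/
lemma two_pow_le_card_ne {P Q : (Fin n → Bool) → G} (hP : P ∈ degreePolys d n G)
    (hQ : Q ∈ degreePolys d n G) (h : P ≠ Q) :
    2 ^ n ≤ 2 ^ d * (Finset.univ.filter fun x => P x ≠ Q x).card := by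
  simpa [sub_eq_zero] using two_pow_le_card_support (sub_mem_degreePolys hP hQ) (sub_ne_zero.2 h)

lemma ncard_degreePolys_le [Finite G] :
    (degreePolys d n G).ncard ≤ Nat.card G ^ (n + 1) ^ d := by
  have hc : ∀ n : ℕ, (Set.range fun (a : G) (_ : Fin n → Bool) => a).ncard ≤ Nat.card G := by
    intro n
    rw [← Set.image_univ, ← Set.ncard_univ]
    exact Set.ncard_image_le Set.finite_univ
  have hpos : 1 ≤ Nat.card G := Nat.card_pos
  induction n generalizing d with
  | zero =>
    refine (Set.ncard_le_ncard (fun P _ => ?_) (Set.toFinite _)).trans ((hc 0).trans (by simp))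
    exact ⟨P 0, funext fun x => congrArg P (Subsingleton.elim _ _)⟩
  | succ n ih =>
    cases d with
    | zero =>
      refine (Set.ncard_le_ncard (fun P hP => ?_) (Set.toFinite _)).trans
        ((hc (n + 1)).trans (by simp))
      obtain ⟨a, ha⟩ := mem_degreePolys_zero.1 hP
      exact ⟨a, (funext ha).symm⟩
    | succ d =>
      have hinj : (degreePolys (d + 1) (n + 1) G).ncard ≤
          (degreePolys (d + 1) n G ×ˢ degreePolys d n G).ncard := by
        refine Set.ncard_le_ncard_of_injOn
          (fun P => (fun y => P (Fin.cons false y),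
            fun y => P (Fin.cons true y) - P (Fin.cons false y)))
          (fun P hP => mem_degreePolys_succ.1 hP) ?_ (Set.toFinite _)
        intro P _ Q _ h
        simp only [Prod.mk.injEq, funext_iff] at h
        refine funext fun x => ?_
        rw [← Fin.cons_self_tail x]
        cases x 0
        · exact h.1 _
        · have := h.2 (Fin.tail x)
          rwa [h.1, sub_left_inj] at this
      refine hinj.trans ?_
      rw [Set.ncard_prod]
      refine (Nat.mul_le_mul ih ih).trans ?_
      rw [← pow_add]
      refine Nat.pow_le_pow_right hpos ?_
      calc (n + 1) ^ (d + 1) + (n + 1) ^ d = (n + 1) ^ d * (n + 2) := by ring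
        _ ≤ (n + 2) ^ d * (n + 2) := Nat.mul_le_mul_right _ (Nat.pow_le_pow_left (by omega) _)
        _ = _ := by ring

end Polynomials

/-! ### Half-cubes and their Fourier coefficients -/

/-- Bessel's inequality for an orthogonal family tested against an indicator function. -/
lemma sum_sq_sum_le {X κ : Type*} [Fintype X] [DecidableEq κ] (K : Finset κ) (ψ : κ → X → ℝ)
    {N : ℝ} (hN : 0 ≤ N)
    (hψ : ∀ k ∈ K, ∀ l ∈ K, ∑ x, ψ k x * ψ l x = if k = l then N else 0)
    (B : Finset X) :
    ∑ k ∈ K, (∑ x ∈ B, ψ k x) ^ 2 ≤ N * B.card := by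
  set c : κ → ℝ := fun k => ∑ x ∈ B, ψ k x with hc
  set g : X → ℝ := fun x => ∑ k ∈ K, c k * ψ k x with hg
  set T := ∑ k ∈ K, c k ^ 2 with hT
  have h1 : T = ∑ x ∈ B, g x := by
    simp only [hg, hT]
    rw [Finset.sum_comm]
    refine Finset.sum_congr rfl fun k _ => ?_
    rw [← Finset.mul_sum, sq]
  have h2 : ∑ x, g x ^ 2 = N * T := by
    have : ∀ x, g x ^ 2 = ∑ k ∈ K, ∑ l ∈ K, c k * c l * (ψ k x * ψ l x) := by
      intro x
      rw [sq, hg, Finset.sum_mul_sum]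
      exact Finset.sum_congr rfl fun k _ => Finset.sum_congr rfl fun l _ => by ring
    simp only [this]
    rw [Finset.sum_comm, hT, Finset.mul_sum]
    refine Finset.sum_congr rfl fun k hk => ?_
    rw [Finset.sum_comm]
    simp only [← Finset.mul_sum]
    rw [Finset.sum_congr rfl fun l hl => by rw [hψ k hk l hl]]
    simp [hk]
    ring
  have h3 : T ^ 2 ≤ B.card * (N * T) := by
    rw [← h2]
    conv_lhs => rw [h1]
    refine sq_sum_le_card_mul_sum_sq.trans ?_
    refine mul_le_mul_of_nonneg_left ?_ (Nat.cast_nonneg _)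
    exact Finset.sum_le_sum_of_subset_of_nonneg (Finset.subset_univ _) fun _ _ _ => sq_nonneg _
  have hT0 : 0 ≤ T := Finset.sum_nonneg fun _ _ => sq_nonneg _
  rcases hT0.eq_or_lt with h | h
  · rw [← h]
    positivity
  · nlinarith

section Halving

variable {d n : ℕ} {G : Type*}

/-- The sign character `(-1)^{x_i + x_j}` of the cube. -/
def pairSign (i j : Fin n) (x : Fin n → Bool) : ℝ := if (x i ^^ x j) then -1 else 1

/-- The two-element subsets `{i, j}` of the coordinates, each listed once with `j < i`. -/
def coordPairs (n : ℕ) : Finset (Fin n × Fin n) := Finset.univ.filter fun p => p.2 < p.1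

lemma card_coordPairs (n : ℕ) : ((coordPairs n).card : ℝ) = n * (n - 1) / 2 := by
  have h : (coordPairs n).card = ∑ i ∈ Finset.range n, i := by
    rw [coordPairs, ← Finset.univ_product_univ, Finset.card_filter, Finset.sum_product,
      Finset.sum_range]
    refine Finset.sum_congr rfl fun i _ => ?_
    rw [← Finset.card_filter, ← Fin.card_Iio i]
    congr 1
    ext j
    simp
  have h2 := Finset.sum_range_id_mul_two n
  rw [← h] at h2
  cases n with
  | zero => simpa using h
  | succ n =>
    have h3 : ((coordPairs (n + 1)).card : ℝ) * 2 = (n + 1) * n := by exact_mod_cast h2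
    push_cast
    linarith

lemma sum_pairSign_mul (p q : Fin n × Fin n) (hp : p ∈ coordPairs n) (hq : q ∈ coordPairs n) :
    ∑ x, pairSign p.1 p.2 x * pairSign q.1 q.2 x = if p = q then (2 : ℝ) ^ n else 0 := by
  obtain ⟨i, j⟩ := p
  obtain ⟨k, l⟩ := q
  simp only [coordPairs, Finset.mem_filter, Finset.mem_univ, true_and] at hp hq
  split_ifs with h
  · obtain ⟨rfl, rfl⟩ := Prod.mk.inj h
    have : ∀ x : Fin n → Bool, pairSign i j x * pairSign i j x = 1 := by
      intro x
      unfold pairSign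
      split_ifs <;> norm_num
    simp [this]
  · -- Some coordinate occurs in exactly one of the two pairs; flipping it negates the summand.
    have key : ∃ t : Fin n, (t = i ∨ t = j) ∧ t ≠ k ∧ t ≠ l := by
      by_contra! hc
      have h1 := hc i (Or.inl rfl)
      have h2 := hc j (Or.inr rfl)
      by_cases hik : i = k
      · by_cases hjk : j = k
        · omega
        · exact h (by rw [hik, h2 hjk])
      · have hil := h1 hik
        by_cases hjk : j = k
        · omega
        · have := h2 hjk
          omega
    obtain ⟨t, ht, htk, htl⟩ := key
    have hflip : ∀ x : Fin n → Bool,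
        pairSign i j (Function.update x t (!x t)) * pairSign k l (Function.update x t (!x t)) =
          -(pairSign i j x * pairSign k l x) := by
      intro x
      have h1 : pairSign k l (Function.update x t (!x t)) = pairSign k l x := by
        simp [pairSign, Function.update_of_ne htk.symm, Function.update_of_ne htl.symm]
      have h2 : pairSign i j (Function.update x t (!x t)) = - pairSign i j x := by
        rcases ht with rfl | rfl
        · simp only [pairSign, Function.update_self, Function.update_of_ne hp.ne]
          cases x t <;> cases x j <;> simp
        · simp only [pairSign, Function.update_self, Function.update_of_ne hp.ne']
          cases x t <;> cases x i <;> simp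
      rw [h1, h2]
      ring
    have hinv : Function.Involutive fun x : Fin n → Bool => Function.update x t (!x t) := by
      intro x
      simp
    have := Equiv.sum_comp hinv.toPerm fun x => pairSign i j x * pairSign k l x
    simp only [Function.Involutive.coe_toPerm, hflip, Finset.sum_neg_distrib] at this
    linarith

/-- The half-cube `{x | x_i ⊕ x_j = s}` is itself a cube of one dimension less. -/
lemma exists_half_embedding (i j : Fin (n + 1)) (h : j ≠ i) (s : Bool) :
    ∃ e : (Fin n → Bool) → (Fin (n + 1) → Bool), Function.Injective e ∧ IsLiteralMap e ∧
      ∀ x, (∃ y, e y = x) ↔ (x i ^^ x j) = s := by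
  obtain ⟨k, rfl⟩ := Fin.exists_succAbove_eq h
  refine ⟨fun y => i.insertNth (s ^^ y k) y, ?_, ?_, ?_⟩
  · intro y z hyz
    exact (Fin.insertNth_inj.1 hyz).2
  · intro l
    refine Or.inr ?_
    rcases eq_or_ne l i with rfl | hl
    · exact ⟨k, s, fun y => by simp⟩
    · obtain ⟨l, rfl⟩ := Fin.exists_succAbove_eq hl
      exact ⟨l, false, fun y => by simp⟩
  · intro x
    constructor
    · rintro ⟨y, rfl⟩
      simp
    · intro hx
      refine ⟨i.removeNth x, ?_⟩
      rw [Fin.insertNth_eq_iff]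
      refine ⟨?_, rfl⟩
      simp [Fin.removeNth, ← hx]

open Classical in
/-- The set of points at which `f` and `P` differ. -/
noncomputable def errorSet (f P : (Fin n → Bool) → G) : Finset (Fin n → Bool) :=
  Finset.univ.filter fun x => f x ≠ P x

lemma fracDist_eq (f P : (Fin n → Bool) → G) :
    fracDist f P = (errorSet f P).card / 2 ^ n := rfl

lemma mem_errorSet {f P : (Fin n → Bool) → G} {x : Fin n → Bool} :
    x ∈ errorSet f P ↔ f x ≠ P x := by simp [errorSet]

/-- The error of a restriction to a half-cube. -/
lemma card_errorSet_comp {i j : Fin (n + 1)} {s : Bool}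
    {e : (Fin n → Bool) → (Fin (n + 1) → Bool)} (he : Function.Injective e)
    (hr : ∀ x, (∃ y, e y = x) ↔ (x i ^^ x j) = s) (f P : (Fin (n + 1) → Bool) → G) :
    (errorSet (f ∘ e) (P ∘ e)).card =
      ((errorSet f P).filter fun x => (x i ^^ x j) = s).card := by
  refine Finset.card_bij (fun y _ => e y) ?_ (fun _ _ _ _ h => he h) ?_
  · intro y hy
    rw [mem_errorSet] at hy
    exact Finset.mem_filter.2 ⟨mem_errorSet.2 hy, (hr _).1 ⟨y, rfl⟩⟩
  · intro x hx
    obtain ⟨hx, hs⟩ := Finset.mem_filter.1 hx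
    obtain ⟨y, rfl⟩ := (hr x).2 hs
    exact ⟨y, mem_errorSet.2 (mem_errorSet (f := f).1 hx), rfl⟩

lemma sum_pairSign (i j : Fin n) (B : Finset (Fin n → Bool)) :
    ∑ x ∈ B, pairSign i j x = (B.filter fun x => (x i ^^ x j) = false).card -
      ((B.filter fun x => (x i ^^ x j) = true).card : ℝ) := by
  simp only [Finset.card_filter, Nat.cast_sum, ← Finset.sum_sub_distrib]
  refine Finset.sum_congr rfl fun x _ => ?_
  unfold pairSign
  cases (x i ^^ x j) <;> simp

lemma card_filter_xor (i j : Fin n) (B : Finset (Fin n → Bool)) :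
    (B.card : ℝ) = (B.filter fun x => (x i ^^ x j) = false).card +
      ((B.filter fun x => (x i ^^ x j) = true).card : ℝ) := by
  rw [← Finset.card_filter_add_card_filter_not (s := B) fun x => (x i ^^ x j) = false]
  simp

/-- A polynomial is determined by its values on a half-cube among those whose distance from `f`
on the other half is less than half the minimum distance of polynomials vanishing on the first
half. -/
lemma eq_of_eqOn_half [AddCommGroup G] {f P Q : (Fin (n + 1) → Bool) → G}
    (hP : P ∈ degreePolys d (n + 1) G) (hQ : Q ∈ degreePolys d (n + 1) G) (i j : Fin (n + 1)) (s : Bool)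
    (hPQ : ∀ x, (x i ^^ x j) = s → P x = Q x)
    (hfP : 2 ^ d * ((errorSet f P).filter fun x => (x i ^^ x j) = !s).card < 2 ^ n)
    (hfQ : 2 ^ d * ((errorSet f Q).filter fun x => (x i ^^ x j) = !s).card < 2 ^ n) : P = Q := by
  classical
  by_contra hne
  have h := two_pow_le_card_ne hP hQ hne
  have hsub : (Finset.univ.filter fun x => P x ≠ Q x) ⊆
      ((errorSet f P).filter fun x => (x i ^^ x j) = !s) ∪
      ((errorSet f Q).filter fun x => (x i ^^ x j) = !s) := by
    intro x hx
    have hx : P x ≠ Q x := by simpa using hx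
    have hs : (x i ^^ x j) = !s := by
      have := mt (hPQ x) hx
      revert this
      cases (x i ^^ x j) <;> cases s <;> simp
    simp only [Finset.mem_union, Finset.mem_filter, mem_errorSet, hs, and_true]
    by_contra! hc
    exact hx (hc.1.symm.trans hc.2)
  have h2 := (Finset.card_le_card hsub).trans (Finset.card_union_le _ _)
  have h3 := h.trans (Nat.mul_le_mul_left _ h2)
  rw [mul_add, pow_succ] at h3
  omega

end Halving

/-! ### The halving potential -/

section Potential

variable {d n : ℕ} {G : Type*}

/-- Averaging the positive part of `τ - density - a` over all half-cubes, where a half-cube counts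
only if `B` has density less than `τ` on the complementary half. The Fourier coefficients of `B`
at pairs of coordinates have square sum at most one, so few half-cubes change the density of `B`
noticeably. -/
lemma le_sum_half_potential (B : Finset (Fin (n + 1) → Bool)) {τ a b : ℝ} (ha : 0 ≤ a)
    (hab : a ≤ b) (hN : 1 ≤ ((n + 1) * n / 2 : ℝ) * ((b - a) * b)) :
    2 * ((n + 1) * n / 2 : ℝ) * max 0 (τ - B.card / 2 ^ (n + 1) - b) ≤
      ∑ p ∈ coordPairs (n + 1), ∑ s : Bool,
        if ((B.filter fun x => (x p.1 ^^ x p.2) = !s).card : ℝ) / 2 ^ n < τ then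
          max 0 (τ - ((B.filter fun x => (x p.1 ^^ x p.2) = s).card : ℝ) / 2 ^ n - a) else 0 := by
  set η : ℝ := τ - B.card / 2 ^ (n + 1) with hη
  set N : ℝ := (n + 1) * n / 2 with hNdef
  have hN0 : 0 ≤ N := by positivity
  have hnn : ∀ p ∈ coordPairs (n + 1), 0 ≤ ∑ s : Bool,
        if ((B.filter fun x => (x p.1 ^^ x p.2) = !s).card : ℝ) / 2 ^ n < τ then
          max 0 (τ - ((B.filter fun x => (x p.1 ^^ x p.2) = s).card : ℝ) / 2 ^ n - a)
        else 0 := by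
    intro p _
    refine Finset.sum_nonneg fun s _ => ?_
    split_ifs
    exacts [le_max_left _ _, le_rfl]
  rcases le_or_gt η b with hb | hb
  · rw [max_eq_left (by linarith), mul_zero]
    exact Finset.sum_nonneg hnn
  have hb0 : 0 < b := by
    rcases (ha.trans hab).eq_or_lt with h | h
    · rw [← h, mul_zero, mul_zero] at hN
      linarith
    · exact h
  have hη0 : 0 < η := hb0.trans hb
  set c : Fin (n + 1) × Fin (n + 1) → ℝ :=
    fun p => (∑ x ∈ B, pairSign p.1 p.2 x) / 2 ^ (n + 1) with hc
  have hbessel : ∑ p ∈ coordPairs (n + 1), c p ^ 2 ≤ 1 := by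
    have h := sum_sq_sum_le (coordPairs (n + 1)) (fun p => pairSign p.1 p.2)
      (by positivity : (0 : ℝ) ≤ 2 ^ (n + 1)) (fun p hp q hq => sum_pairSign_mul p q hp hq) B
    have hB : (B.card : ℝ) ≤ 2 ^ (n + 1) := by
      have := Finset.card_le_univ B
      rw [Fintype.card_fun, Fintype.card_bool, Fintype.card_fin] at this
      exact_mod_cast this
    simp only [hc, div_pow]
    rw [← Finset.sum_div, div_le_one (by positivity), sq (2 ^ (n + 1) : ℝ)]
    exact h.trans (mul_le_mul_of_nonneg_left hB (by positivity))
  have hpair : ∀ p ∈ coordPairs (n + 1), 2 * (η - a) * (1 - c p ^ 2 / η ^ 2) ≤ ∑ s : Bool,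
        if ((B.filter fun x => (x p.1 ^^ x p.2) = !s).card : ℝ) / 2 ^ n < τ then
          max 0 (τ - ((B.filter fun x => (x p.1 ^^ x p.2) = s).card : ℝ) / 2 ^ n - a)
        else 0 := by
    intro p hp
    -- For a large coefficient the left side is not positive. For a small one both halves count,
    -- and the changes of density on them cancel.
    rcases le_or_gt (η ^ 2) (c p ^ 2) with hcη | hcη
    · refine le_trans ?_ (hnn p hp)
      have : 1 ≤ c p ^ 2 / η ^ 2 := by rwa [one_le_div (by positivity)]
      nlinarith
    · have h1 := sum_pairSign p.1 p.2 B
      have h2 := card_filter_xor p.1 p.2 B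
      have hF : ((B.filter fun x => (x p.1 ^^ x p.2) = false).card : ℝ) / 2 ^ n =
          τ - η + c p := by
        simp only [hη, hc, h1, pow_succ (2 : ℝ) n]
        rw [h2]
        field_simp
        ring
      have hT : ((B.filter fun x => (x p.1 ^^ x p.2) = true).card : ℝ) / 2 ^ n =
          τ - η - c p := by
        simp only [hη, hc, h1, pow_succ (2 : ℝ) n]
        rw [h2]
        field_simp
        ring
      obtain ⟨hl, hr⟩ := abs_lt.1 (abs_lt_of_sq_lt_sq hcη hη0.le)
      rw [Fintype.sum_bool, Bool.not_true, Bool.not_false, hF, hT, if_pos (by linarith),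
        if_pos (by linarith)]
      have h3 := le_max_right 0 (τ - (τ - η + c p) - a)
      have h4 := le_max_right 0 (τ - (τ - η - c p) - a)
      have h5 : 0 ≤ c p ^ 2 / η ^ 2 := by positivity
      nlinarith
  refine le_trans ?_ (Finset.sum_le_sum hpair)
  have hcard : ((coordPairs (n + 1)).card : ℝ) = N := by
    rw [card_coordPairs, hNdef]
    push_cast
    ring
  rw [← Finset.mul_sum, Finset.sum_sub_distrib, ← Finset.sum_div, Finset.sum_const, nsmul_eq_mul,
    hcard, mul_one, max_eq_right (by linarith)]
  have h6 : (∑ p ∈ coordPairs (n + 1), c p ^ 2) / η ^ 2 ≤ 1 / η ^ 2 := by gcongr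
  have h7 : (η - a) * (1 / η ^ 2) ≤ N * (b - a) := by
    rw [mul_one_div, div_le_iff₀ (by positivity)]
    have h8 : 0 ≤ N * (b - a) := mul_nonneg hN0 (by linarith)
    have h9 : η ≤ N * (b - a) * b * η := by nlinarith
    have h10 : N * (b - a) * b * η ≤ N * (b - a) * η * η := by gcongr
    nlinarith
  have h11 : (η - a) * ((∑ p ∈ coordPairs (n + 1), c p ^ 2) / η ^ 2) ≤ (η - a) * (1 / η ^ 2) :=
    mul_le_mul_of_nonneg_left h6 (by linarith)
  nlinarith

/-- The total loss of the potential when halving from dimension `n` down to dimension `k`. Its square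
telescopes: `halvingLoss k (n + 1) ^ 2 - halvingLoss k n ^ 2 = 4 / (n * (n + 1))`, which is twice the
reciprocal of the number of pairs of coordinates in dimension `n + 1`. -/
noncomputable def halvingLoss (k n : ℕ) : ℝ := 2 * √(1 / k - 1 / n)

lemma halvingLoss_step {k n : ℕ} (hk : 1 ≤ k) (hn : k ≤ n) :
    0 ≤ halvingLoss k n ∧ halvingLoss k n ≤ halvingLoss k (n + 1) ∧
    1 ≤ ((n + 1) * n / 2 : ℝ) *
      ((halvingLoss k (n + 1) - halvingLoss k n) * halvingLoss k (n + 1)) := by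
  have hk0 : (0 : ℝ) < k := by exact_mod_cast hk
  have hkn : (k : ℝ) ≤ n := by exact_mod_cast hn
  have hn0 : (0 : ℝ) < n := hk0.trans_le hkn
  have h1 : (1 : ℝ) / n ≤ 1 / k := one_div_le_one_div_of_le hk0 hkn
  have h2 : (1 : ℝ) / (n + 1 : ℕ) ≤ 1 / n := by
    push_cast
    exact one_div_le_one_div_of_le hn0 (by linarith)
  have hle : halvingLoss k n ≤ halvingLoss k (n + 1) := by
    unfold halvingLoss
    gcongr
  have h0 : 0 ≤ halvingLoss k n := by unfold halvingLoss; positivity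
  refine ⟨h0, hle, ?_⟩
  have hs1 : halvingLoss k n ^ 2 = 4 * (1 / k - 1 / n) := by
    rw [halvingLoss, mul_pow, Real.sq_sqrt (by linarith)]; norm_num
  have hs2 : halvingLoss k (n + 1) ^ 2 = 4 * (1 / k - 1 / (n + 1)) := by
    rw [halvingLoss, mul_pow, Real.sq_sqrt (by linarith)]; push_cast; norm_num
  have hs3 : halvingLoss k (n + 1) ^ 2 - halvingLoss k n ^ 2 = 4 / (n * (n + 1)) := by
    rw [hs1, hs2]
    field_simp
    ring
  have h4 : 2 / (n * (n + 1) : ℝ) ≤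
      (halvingLoss k (n + 1) - halvingLoss k n) * halvingLoss k (n + 1) := by
    have : 4 / (n * (n + 1) : ℝ) = 2 * (2 / (n * (n + 1))) := by ring
    nlinarith
  calc (1 : ℝ) = ((n + 1) * n / 2 : ℝ) * (2 / (n * (n + 1))) := by field_simp
    _ ≤ _ := by gcongr

lemma halvingLoss_le {k n : ℕ} : halvingLoss k n ≤ 2 * √(1 / k) := by
  unfold halvingLoss
  gcongr
  have : (0 : ℝ) ≤ 1 / n := by positivity
  linarith

open Classical in
/-- The potential bound, by halving the cube down to dimension `k`, where all polynomials of
degree at most `d` are counted. -/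
lemma sum_potential_le [AddCommGroup G] [Finite G] {k : ℕ} (hk : 1 ≤ k) (hn : k ≤ n)
    (f : (Fin n → Bool) → G) (T : Finset ((Fin n → Bool) → G))
    (hT : ∀ P ∈ T, P ∈ degreePolys d n G) :
    ∑ P ∈ T, max 0 (1 / 2 ^ d - fracDist f P - halvingLoss k n) ≤
      (Nat.card G : ℝ) ^ (k + 1) ^ d := by
  induction n, hn using Nat.le_induction with
  | base =>
    have h1 : ∀ P ∈ T, max 0 (1 / 2 ^ d - fracDist f P - halvingLoss k k) ≤ 1 := by
      intro P _
      have h2 : 0 ≤ fracDist f P := by unfold fracDist; positivity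
      have h3 : (1 : ℝ) / 2 ^ d ≤ 1 := by
        rw [div_le_one (by positivity)]
        exact one_le_pow₀ one_le_two
      refine max_le zero_le_one ?_
      simp only [halvingLoss, sub_self, Real.sqrt_zero, mul_zero]
      linarith
    refine (Finset.sum_le_sum h1).trans ?_
    have h4 : T.card ≤ (degreePolys d k G).ncard := by
      rw [← Set.ncard_coe_finset]
      exact Set.ncard_le_ncard (fun P hP => hT P hP) (Set.toFinite _)
    simp only [Finset.sum_const, nsmul_eq_mul, mul_one]
    exact_mod_cast h4.trans ncard_degreePolys_le
  | succ n hn ih =>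
    obtain ⟨ha, hab, hN⟩ := halvingLoss_step hk hn
    set M : ℝ := (Nat.card G : ℝ) ^ (k + 1) ^ d
    set N : ℝ := (n + 1) * n / 2 with hNdef
    have hN0 : 0 < N := by
      have : (0 : ℝ) < n := by exact_mod_cast hk.trans hn
      positivity
    -- On each half-cube, the polynomials with small error on the other half restrict injectively.
    have hhalf : ∀ p ∈ coordPairs (n + 1), ∀ s : Bool,
        (∑ P ∈ T, if (((errorSet f P).filter fun x => (x p.1 ^^ x p.2) = !s).card : ℝ) / 2 ^ n <
            1 / 2 ^ d then
          max 0 (1 / 2 ^ d - (((errorSet f P).filter fun x => (x p.1 ^^ x p.2) = s).card : ℝ) /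
            2 ^ n - halvingLoss k n) else 0) ≤ M := by
      intro p hp s
      have hp' : p.2 < p.1 := by simpa [coordPairs] using hp
      obtain ⟨e, he, hl, hr⟩ := exists_half_embedding p.1 p.2 hp'.ne s
      rw [← Finset.sum_filter]
      set T' := T.filter fun P =>
        (((errorSet f P).filter fun x => (x p.1 ^^ x p.2) = !s).card : ℝ) / 2 ^ n < 1 / 2 ^ d
        with hT'
      have hsmall : ∀ P ∈ T',
          2 ^ d * ((errorSet f P).filter fun x => (x p.1 ^^ x p.2) = !s).card < 2 ^ n := by
        intro P hP
        have h := (Finset.mem_filter.1 hP).2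
        rw [div_lt_div_iff₀ (by positivity) (by positivity), one_mul, mul_comm] at h
        exact_mod_cast h
      have hinj : Set.InjOn (fun P : (Fin (n + 1) → Bool) → G => P ∘ e) T' := by
        intro P hP Q hQ hPQ
        refine eq_of_eqOn_half (hT P (Finset.mem_filter.1 hP).1) (hT Q (Finset.mem_filter.1 hQ).1)
          p.1 p.2 s (fun x hx => ?_) (hsmall P hP) (hsmall Q hQ)
        obtain ⟨y, rfl⟩ := (hr x).2 hx
        exact congrFun hPQ y
      have h := ih (f ∘ e) (T'.image fun P => P ∘ e) (by
        intro Q hQ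
        obtain ⟨P, hP, rfl⟩ := Finset.mem_image.1 hQ
        exact hl.comp_mem (hT P (Finset.mem_filter.1 hP).1))
      rw [Finset.sum_image hinj] at h
      simpa only [fracDist_eq, card_errorSet_comp he hr] using h
    have hsum : ∑ P ∈ T, 2 * N * max 0 (1 / 2 ^ d - fracDist f P - halvingLoss k (n + 1)) ≤
        2 * N * M := by
      refine (Finset.sum_le_sum fun P _ =>
        le_sum_half_potential (errorSet f P) (τ := 1 / 2 ^ d) ha hab hN).trans ?_
      rw [Finset.sum_comm]
      calc _ ≤ ∑ p ∈ coordPairs (n + 1), 2 * M := by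
            refine Finset.sum_le_sum fun p hp => ?_
            rw [Finset.sum_comm]
            refine (Finset.sum_le_sum fun s _ => hhalf p hp s).trans ?_
            simp
        _ = _ := by
            rw [Finset.sum_const, nsmul_eq_mul, card_coordPairs, hNdef]
            push_cast
            ring
    rw [← Finset.mul_sum] at hsum
    exact le_of_mul_le_mul_left hsum (by positivity)

/-- The list bound over a finite group in terms of the dimension `k` of the final cube. The minimum
with `1` covers `n < k`, where all polynomials are counted directly and `ε` need not be small. -/
lemma card_mul_le [AddCommGroup G] [Finite G] {k : ℕ} (hk : 1 ≤ k) {ε : ℝ}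
    (hε : 2 * √(1 / k) ≤ ε / 2) (f : (Fin n → Bool) → G) (T : Finset ((Fin n → Bool) → G))
    (hT : ∀ P ∈ T, P ∈ closeList (degreePolys d n G) (1 / 2 ^ d - ε) f) :
    T.card * min 1 (ε / 2) ≤ (Nat.card G : ℝ) ^ (k + 1) ^ d := by
  have hε0 : 0 ≤ ε / 2 := le_trans (by positivity) hε
  rcases le_or_gt k n with hn | hn
  · refine le_trans ?_ (sum_potential_le hk hn f T fun P hP => (hT P hP).1)
    rw [← nsmul_eq_mul]
    refine Finset.card_nsmul_le_sum _ _ _ fun P hP => ?_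
    have h1 := (hT P hP).2
    have h2 := halvingLoss_le (k := k) (n := n)
    exact (min_le_right _ _).trans (le_max_of_le_right (by linarith))
  · have h4 : T.card ≤ (degreePolys d n G).ncard := by
      rw [← Set.ncard_coe_finset]
      exact Set.ncard_le_ncard (fun P hP => (hT P hP).1) (Set.toFinite _)
    have h5 : Nat.card G ^ (n + 1) ^ d ≤ Nat.card G ^ (k + 1) ^ d :=
      Nat.pow_le_pow_right Nat.card_pos (Nat.pow_le_pow_left (by omega) _)
    have h6 : (T.card : ℝ) ≤ (Nat.card G : ℝ) ^ (k + 1) ^ d := by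
      exact_mod_cast (h4.trans ncard_degreePolys_le).trans h5
    exact (mul_le_of_le_one_right (Nat.cast_nonneg _) (min_le_left _ _)).trans h6

end Potential

/-! ### Lists over finite groups -/

section ListBound

variable {d n : ℕ} {G : Type*}

lemma closeList_eq_empty {F : Set ((Fin n → Bool) → G)} {δ : ℝ} (hδ : δ < 0)
    (f : (Fin n → Bool) → G) : closeList F δ f = ∅ := by
  refine Set.eq_empty_of_forall_notMem fun P hP => ?_
  have : 0 ≤ fracDist f P := by unfold fracDist; positivity
  linarith [hP.2]

/-- To bound a list it suffices to bound its finite subsets. -/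
lemma isListDecodable_of_finset {F : Set ((Fin n → Bool) → G)} {δ L : ℝ}
    (h : ∀ f, ∀ T : Finset ((Fin n → Bool) → G), (∀ P ∈ T, P ∈ closeList F δ f) → T.card ≤ L) :
    IsListDecodable F δ L := by
  intro f
  have hfin : (closeList F δ f).Finite := by
    by_contra hinf
    obtain ⟨T, hT, hc⟩ := Set.Infinite.exists_subset_card_eq hinf (⌊L⌋₊ + 1)
    have h1 := h f T fun P hP => hT hP
    rw [hc] at h1
    push_cast at h1
    linarith [Nat.lt_floor_add_one L]
  refine ⟨hfin, ?_⟩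
  rw [Set.ncard_eq_toFinset_card _ hfin]
  exact h f _ fun P hP => by simpa using hP

lemma IsListDecodable.mono {F : Set ((Fin n → Bool) → G)} {δ L L' : ℝ}
    (h : IsListDecodable F δ L) (hL : L ≤ L') : IsListDecodable F δ L' :=
  fun f => ⟨(h f).1, (h f).2.trans hL⟩

/-- List decodability over a finite group, with a bound that depends on its order. -/
lemma isListDecodable_of_finite [AddCommGroup G] [Finite G] (hd : 1 ≤ d) {q : ℕ}
    (hq : Nat.card G ≤ q) {ε : ℝ} (hε : 0 < ε) :
    IsListDecodable (degreePolys d n G) (1 / 2 ^ d - ε)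
      (Real.exp ((18 * (2 + q) / ε) ^ (2 * d))) := by
  refine isListDecodable_of_finset fun f T hT => ?_
  rcases lt_or_ge (1 / 2 ^ d : ℝ) ε with h | h
  · rw [closeList_eq_empty (by linarith)] at hT
    rw [Finset.eq_empty_of_forall_notMem hT]
    simpa using Real.exp_nonneg _
  have hε1 : ε ≤ 1 := h.trans <| by
    rw [div_le_one (by positivity)]
    exact one_le_pow₀ one_le_two
  -- With this dimension the halving loss, at most `2 / √k`, is at most `ε / 2`.
  set k := ⌈16 / ε ^ 2⌉₊ with hk
  have hk16 : 16 / ε ^ 2 ≤ k := Nat.le_ceil _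
  have hk0 : (0 : ℝ) < k := lt_of_lt_of_le (by positivity) hk16
  have hsqrt : 2 * √(1 / k) ≤ ε / 2 := by
    have : √(1 / k) ≤ ε / 4 := by
      rw [Real.sqrt_le_left (by positivity), div_le_iff₀ hk0]
      calc (1 : ℝ) = (ε / 4) ^ 2 * (16 / ε ^ 2) := by field_simp; norm_num
        _ ≤ _ := by gcongr
    linarith
  have hε2 : 1 ≤ 1 / ε ^ 2 := by
    rw [le_div_iff₀ (by positivity)]
    nlinarith
  have hk18 : (k : ℝ) + 1 ≤ 18 / ε ^ 2 := by
    have h1 : (k : ℝ) < 16 / ε ^ 2 + 1 := Nat.ceil_lt_add_one (by positivity)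
    have h2 : 18 / ε ^ 2 = 16 / ε ^ 2 + 2 * (1 / ε ^ 2) := by ring
    linarith
  have hmain := card_mul_le (by exact_mod_cast hk0) hsqrt f T hT
  rw [min_eq_right (by linarith)] at hmain
  have hqe : (Nat.card G : ℝ) ≤ Real.exp q := by
    have : (Nat.card G : ℝ) ≤ q := by exact_mod_cast hq
    linarith [Real.add_one_le_exp (q : ℝ)]
  have h2e : 2 / ε ≤ Real.exp (2 / ε) := by linarith [Real.add_one_le_exp (2 / ε)]
  calc (T.card : ℝ) = 2 / ε * (T.card * (ε / 2)) := by field_simp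
    _ ≤ Real.exp (2 / ε) * Real.exp q ^ (k + 1) ^ d := by
        gcongr
        exact hmain.trans (by gcongr)
    _ = Real.exp (2 / ε + (k + 1 : ℝ) ^ d * q) := by
        rw [Real.exp_add, ← Real.exp_nat_mul]
        push_cast
        rfl
    _ ≤ Real.exp ((18 * (2 + q) / ε) ^ (2 * d)) := by
        refine Real.exp_le_exp.2 ?_
        have h1 : 2 / ε ≤ 2 * (18 / ε ^ 2) ^ d := by
          have h3 : 1 / ε ≤ 18 / ε ^ 2 := by
            rw [div_le_div_iff₀ hε (by positivity)]
            nlinarith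
          have h4 : 18 / ε ^ 2 ≤ (18 / ε ^ 2) ^ d :=
            le_self_pow₀ (by linarith) (by omega)
          calc 2 / ε = 2 * (1 / ε) := by ring
            _ ≤ _ := by linarith
        have h2 : (k + 1 : ℝ) ^ d * q ≤ (18 / ε ^ 2) ^ d * q := by gcongr
        have hq0 : (0 : ℝ) ≤ q := Nat.cast_nonneg q
        calc 2 / ε + (k + 1 : ℝ) ^ d * q ≤ (2 + q) * (18 / ε ^ 2) ^ d := by linarith
          _ ≤ (2 + q) ^ (2 * d) * (18 ^ 2 / ε ^ 2) ^ d := by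
              gcongr
              · exact le_self_pow₀ (by linarith) (by omega)
              · norm_num
          _ = _ := by
              rw [pow_mul, pow_mul, ← mul_pow]
              congr 1
              ring

end ListBound

/-! ### Lifting from prime fields -/

section Lifting

variable {d n : ℕ}

/-- A nontrivial finite abelian group has a nonzero homomorphism to a prime field whose
characteristic divides its order. -/
lemma exists_hom_zmod_ne_zero (K : Type*) [AddCommGroup K] [Finite K] [Nontrivial K] :
    ∃ q : ℕ, q.Prime ∧ q ∣ Nat.card K ∧ ∃ φ : K →+ ZMod q, φ ≠ 0 := by
  obtain ⟨q, hq, hdvd⟩ := Nat.exists_prime_and_dvd (Finite.one_lt_card (α := K)).ne'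
  have : Fact q.Prime := ⟨hq⟩
  refine ⟨q, hq, hdvd, ?_⟩
  -- `K ⧸ qK` is a nontrivial vector space over `ℤ_q`, so it has a nonzero functional.
  set R := (nsmulAddMonoidHom q : K →+ K).range with hR
  have hne : R ≠ ⊤ := by
    intro h
    have hsurj : Function.Surjective (nsmulAddMonoidHom q : K →+ K) :=
      AddMonoidHom.range_eq_top.1 h
    have hinj := Finite.injective_iff_surjective.2 hsurj
    obtain ⟨x, hx⟩ := exists_prime_addOrderOf_dvd_card' q hdvd
    have hx0 : x = 0 := hinj (by simp [← hx, addOrderOf_nsmul_eq_zero])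
    rw [hx0, addOrderOf_zero] at hx
    exact hq.one_lt.ne hx
  have : Module (ZMod q) (K ⧸ R) := AddCommGroup.zmodModule (by
    intro x
    induction x using QuotientAddGroup.induction_on with
    | H x =>
      rw [← QuotientAddGroup.mk_nsmul, QuotientAddGroup.eq_zero_iff]
      exact ⟨x, rfl⟩)
  obtain ⟨x, -, hx⟩ := SetLike.exists_of_lt (lt_top_iff_ne_top.2 hne)
  have hx' : (QuotientAddGroup.mk x : K ⧸ R) ≠ 0 := by
    rwa [Ne, QuotientAddGroup.eq_zero_iff]
  have := mt (Module.forall_dual_apply_eq_zero_iff (ZMod q) _).1 hx'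
  push Not at this
  obtain ⟨g, hg⟩ := this
  refine ⟨g.toAddMonoidHom.comp (QuotientAddGroup.mk' R), fun h => hg ?_⟩
  exact DFunLike.congr_fun h x

lemma add_pow_ge {v w : ℝ} (hw : 0 ≤ w) (hv : w ≤ v) (a : ℕ) :
    v ^ a + (2 ^ a - 1) * w ^ a ≤ (v + w) ^ a := by
  induction a with
  | zero => simp
  | succ a ih =>
    have h1 : w ^ a ≤ v ^ a := pow_le_pow_left₀ hw hv a
    have h2 : (0 : ℝ) ≤ 2 ^ a - 1 := sub_nonneg.2 (one_le_pow₀ one_le_two)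
    have h3 : (v + w) * (v ^ a + (2 ^ a - 1) * w ^ a) ≤ (v + w) * (v + w) ^ a :=
      mul_le_mul_of_nonneg_left ih (by linarith)
    have h4 : w * w ^ a ≤ w * v ^ a := mul_le_mul_of_nonneg_left h1 hw
    have h5 : 2 * w * ((2 ^ a - 1) * w ^ a) ≤ (v + w) * ((2 ^ a - 1) * w ^ a) :=
      mul_le_mul_of_nonneg_right (by linarith) (by positivity)
    simp only [pow_succ]
    nlinarith

/-- Superadditivity of `a`-th powers for up to `2 ^ a` numbers any two of which add up to at
most `E`: the largest number may be close to `E`, and then all others are small. -/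
lemma sum_pow_le_pow {ι : Type*} {U : Finset ι} {e : ι → ℝ} {E : ℝ} {a : ℕ}
    (hU : U.Nonempty) (he : ∀ u ∈ U, 0 ≤ e u) (hE : ∀ u ∈ U, e u ≤ E)
    (hpair : ∀ u ∈ U, ∀ v ∈ U, u ≠ v → e u + e v ≤ E) (hcard : U.card ≤ 2 ^ a) :
    ∑ u ∈ U, e u ^ a ≤ E ^ a := by
  classical
  obtain ⟨m, hm, hmax⟩ := U.exists_max_image e hU
  set w := min (e m) (E - e m)
  have hw0 : 0 ≤ w := le_min (he m hm) (sub_nonneg.2 (hE m hm))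
  have hrest : ∀ u ∈ U.erase m, e u ^ a ≤ w ^ a := by
    intro u hu
    obtain ⟨hne, hu⟩ := Finset.mem_erase.1 hu
    exact pow_le_pow_left₀ (he u hu)
      (le_min (hmax u hu) (by linarith [hpair u hu m hm hne])) a
  have hc : ((U.erase m).card : ℝ) ≤ 2 ^ a - 1 := by
    rw [Finset.card_erase_of_mem hm, Nat.cast_sub (Finset.card_pos.2 hU)]
    have : (U.card : ℝ) ≤ 2 ^ a := by exact_mod_cast hcard
    push_cast
    linarith
  calc ∑ u ∈ U, e u ^ a = e m ^ a + ∑ u ∈ U.erase m, e u ^ a :=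
        (Finset.add_sum_erase U (fun u => e u ^ a) hm).symm
    _ ≤ e m ^ a + (U.erase m).card * w ^ a := by
        rw [← nsmul_eq_mul]
        gcongr
        exact Finset.sum_le_card_nsmul _ _ _ hrest
    _ ≤ e m ^ a + (2 ^ a - 1) * w ^ a := by gcongr
    _ ≤ (e m + w) ^ a := add_pow_ge hw0 (min_le_left _ _) a
    _ ≤ E ^ a := pow_le_pow_left₀ (add_nonneg (he m hm) hw0)
        (by linarith [min_le_right (e m) (E - e m)]) a

/-- The amount by which the density of `D` exceeds `1 - 2⁻ᵈ`, the largest density on which two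
distinct polynomials of degree at most `d` can agree. -/
noncomputable def excess (d : ℕ) (D : Finset (Fin n → Bool)) : ℝ :=
  D.card / 2 ^ n - (1 - 1 / 2 ^ d)

lemma excess_mono {D D' : Finset (Fin n → Bool)} (h : D ⊆ D') : excess d D ≤ excess d D' := by
  unfold excess
  gcongr

/-- The excesses of the sets on which `g` agrees with two distinct polynomials add up to at most the
excess of the domain, since these sets meet only where the polynomials agree. -/
lemma excess_add_le {G : Type*} [AddCommGroup G] [DecidableEq G] {P Q g : (Fin n → Bool) → G}
    (hP : P ∈ degreePolys d n G) (hQ : Q ∈ degreePolys d n G) (hne : P ≠ Q)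
    (D : Finset (Fin n → Bool)) :
    excess d (D.filter fun x => g x = P x) + excess d (D.filter fun x => g x = Q x) ≤
      excess d D := by
  set A := D.filter fun x => g x = P x
  set B := D.filter fun x => g x = Q x
  set W := Finset.univ.filter fun x => P x ≠ Q x
  have h0 : 2 ^ n ≤ 2 ^ d * W.card := by convert two_pow_le_card_ne hP hQ hne
  have h1 : (2 : ℝ) ^ n ≤ 2 ^ d * W.card := by exact_mod_cast h0
  have h2 : (A ∪ B).card ≤ D.card :=
    Finset.card_le_card (Finset.union_subset (Finset.filter_subset _ _) (Finset.filter_subset _ _))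
  have h3 : (A ∩ B).card + W.card ≤ 2 ^ n := by
    rw [← Finset.card_union_of_disjoint]
    · exact (Finset.card_le_univ _).trans (by simp)
    · refine Finset.disjoint_left.2 fun x hx hW => ?_
      simp only [A, B, W, Finset.mem_inter, Finset.mem_filter, Finset.mem_univ, true_and] at hx hW
      exact hW (hx.1.2.symm.trans hx.2.2)
  have h4 := Finset.card_union_add_card_inter A B
  have h5 : (A.card : ℝ) + B.card ≤ D.card + 2 ^ n - W.card := by
    have h6 : A.card + B.card + W.card ≤ D.card + 2 ^ n := by omega
    have h7 : (A.card : ℝ) + B.card + W.card ≤ D.card + 2 ^ n := by exact_mod_cast h6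
    linarith
  have h8 : 1 / 2 ^ d ≤ (W.card : ℝ) / 2 ^ n := by
    rw [div_le_div_iff₀ (by positivity) (by positivity)]
    linarith
  have h9 : (A.card : ℝ) / 2 ^ n + B.card / 2 ^ n ≤ D.card / 2 ^ n + 1 - W.card / 2 ^ n := by
    have : (A.card : ℝ) / 2 ^ n + B.card / 2 ^ n ≤ (D.card + 2 ^ n - W.card) / 2 ^ n := by
      rw [← add_div]
      gcongr
    rwa [sub_div, add_div, div_self (by positivity)] at this
  unfold excess
  linarith

lemma le_excess_iff {G : Type*} [DecidableEq G] {f P : (Fin n → Bool) → G} {ε : ℝ} :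
    ε ≤ excess d (Finset.univ.filter fun x => f x = P x) ↔ fracDist f P ≤ 1 / 2 ^ d - ε := by
  have h1 : ((Finset.univ.filter fun x => f x = P x).card : ℝ) + (errorSet f P).card = 2 ^ n := by
    have := Finset.card_filter_add_card_filter_not (s := Finset.univ) fun x => f x = P x
    rw [Finset.card_univ, Fintype.card_fun, Fintype.card_bool, Fintype.card_fin] at this
    rw [errorSet, ← Nat.cast_add]
    norm_cast
  rw [excess, fracDist_eq]
  have h2 : ((Finset.univ.filter fun x => f x = P x).card : ℝ) / 2 ^ n =
      1 - (errorSet f P).card / 2 ^ n := by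
    rw [eq_sub_iff_add_eq, ← add_div, h1, div_self (by positivity)]
  rw [h2]
  constructor <;> intro h <;> linarith

open Classical in
/-- The retraction of a group onto a subgroup that is the identity on the subgroup and zero
elsewhere. It is a homomorphism only in trivial cases; it serves to regard functions with values in
the subgroup as such, whatever happens at other points. -/
noncomputable def retractTo {K : Type*} [AddCommGroup K] (H : AddSubgroup K) (z : K) : H :=
  if h : z ∈ H then ⟨z, h⟩ else 0

lemma coe_retractTo {K : Type*} [AddCommGroup K] {H : AddSubgroup K} {z : K} (h : z ∈ H) :
    (retractTo H z : K) = z := by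
  simp [retractTo, h]

lemma retractTo_comp_mem {K : Type*} [AddCommGroup K] {H : AddSubgroup K}
    {P : (Fin n → Bool) → K} (hP : P ∈ degreePolys d n K) (h : ∀ x, P x ∈ H) :
    retractTo H ∘ P ∈ degreePolys d n H := by
  refine mem_degreePolys_of_injective H.subtype H.subtype_injective ?_
  convert hP using 1
  exact funext fun x => coe_retractTo (h x)

open Classical in
/-- The lifting argument for finite groups. The list is grouped by the images of its members
under a nonzero homomorphism to a prime field; each group is a list over the kernel, on a smaller
domain. For `L = 1` the exponent is zero and the bound says that the list has one member. -/
lemma card_le_excess_pow {S : Set ℕ} {ε : ℝ} (hε : 0 < ε) {L : ℕ}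
    (hS : ∀ p ∈ S, IsListDecodable (degreePolys d n (ZMod p)) (1 / 2 ^ d - ε) L)
    (K : Type u) [AddCommGroup K] [Finite K] (hK : ∀ q : ℕ, q.Prime → q ∣ Nat.card K → q ∈ S)
    (D : Finset (Fin n → Bool)) (f : (Fin n → Bool) → K) (T : Finset ((Fin n → Bool) → K))
    (hne : T.Nonempty) (hT : ∀ P ∈ T, P ∈ degreePolys d n K)
    (hTε : ∀ P ∈ T, ε ≤ excess d (D.filter fun x => f x = P x)) :
    (T.card : ℝ) ≤ (excess d D / ε) ^ Nat.clog 2 L := by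
  induction hm : Nat.card K using Nat.strong_induction_on generalizing K D with
  | _ m ih =>
    subst hm
    rcases subsingleton_or_nontrivial K with hK1 | hK1
    · obtain ⟨P, hP⟩ := hne
      have h1 : T.card ≤ 1 := Finset.card_le_one.2 fun P _ Q _ => Subsingleton.elim P Q
      have h2 : 1 ≤ excess d D / ε := by
        rw [le_div_iff₀ hε, one_mul]
        exact (hTε P hP).trans (excess_mono (Finset.filter_subset _ _))
      calc (T.card : ℝ) ≤ 1 := by exact_mod_cast h1
        _ ≤ _ := one_le_pow₀ h2
    obtain ⟨q, hq, hqK, φ, hφ⟩ := exists_hom_zmod_ne_zero K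
    set U := T.image fun P => φ ∘ P with hU
    set Du : ((Fin n → Bool) → ZMod q) → Finset (Fin n → Bool) :=
      fun u => D.filter fun x => φ (f x) = u x with hDu
    have hagree : ∀ P ∈ T, ε ≤ excess d (Du (φ ∘ P)) := by
      intro P hP
      refine (hTε P hP).trans (excess_mono fun x hx => ?_)
      rw [Finset.mem_filter] at hx ⊢
      exact ⟨hx.1, congrArg φ hx.2⟩
    have hUpoly : ∀ u ∈ U, u ∈ degreePolys d n (ZMod q) := by
      intro u hu
      obtain ⟨P, hP, rfl⟩ := Finset.mem_image.1 hu
      exact φ.comp_mem_degreePolys (hT P hP)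
    have hUε : ∀ u ∈ U, ε ≤ excess d (Du u) := by
      intro u hu
      obtain ⟨P, hP, rfl⟩ := Finset.mem_image.1 hu
      exact hagree P hP
    have hUcard : U.card ≤ 2 ^ Nat.clog 2 L := by
      refine le_trans ?_ (Nat.le_pow_clog one_lt_two L)
      obtain ⟨hfin, hle⟩ := hS q (hK q hq hqK) (φ ∘ f)
      have hsub : (U : Set ((Fin n → Bool) → ZMod q)) ⊆
          closeList (degreePolys d n (ZMod q)) (1 / 2 ^ d - ε) (φ ∘ f) := by
        intro u hu
        refine ⟨hUpoly u hu, le_excess_iff.1 ((hUε u hu).trans (excess_mono ?_))⟩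
        exact Finset.filter_subset_filter _ (Finset.subset_univ _)
      have h := Set.ncard_le_ncard hsub hfin
      rw [Set.ncard_coe_finset] at h
      exact h.trans (by exact_mod_cast hle)
    have hker : Nat.card φ.ker < Nat.card K := by
      rw [← AddSubgroup.card_mul_index φ.ker]
      refine lt_mul_of_one_lt_right Nat.card_pos ?_
      have h1 : φ.ker.index ≠ 0 := AddSubgroup.index_ne_zero_of_finite
      have h2 : φ.ker.index ≠ 1 := by
        rw [Ne, AddSubgroup.index_eq_one]
        intro h
        exact hφ (AddMonoidHom.ext fun x => (AddMonoidHom.mem_ker).1 (h ▸ AddSubgroup.mem_top x))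
      omega
    have hfiber : ∀ u ∈ U, ((T.filter fun P => φ ∘ P = u).card : ℝ) ≤
        (excess d (Du u) / ε) ^ Nat.clog 2 L := by
      intro u hu
      obtain ⟨Q, hQ, rfl⟩ := Finset.mem_image.1 hu
      -- Subtracting the member `Q` moves the whole group into the kernel.
      set Tu := T.filter fun P => φ ∘ P = φ ∘ Q with hTu
      have hmem : ∀ P ∈ Tu, ∀ x, P x - Q x ∈ φ.ker := by
        intro P hP x
        have := congrFun (Finset.mem_filter.1 hP).2 x
        rw [AddMonoidHom.mem_ker, map_sub, sub_eq_zero]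
        exact this
      have hinj : Set.InjOn (fun P => retractTo φ.ker ∘ (P - Q)) (Tu : Set ((Fin n → Bool) → K)) := by
        intro P hP P' hP' h
        refine funext fun x => ?_
        have h1 := congrArg Subtype.val (congrFun h x)
        simp only [Function.comp_apply, Pi.sub_apply] at h1
        rw [coe_retractTo (hmem P hP x), coe_retractTo (hmem P' hP' x)] at h1
        exact sub_left_inj.1 h1
      rw [← Finset.card_image_of_injOn hinj]
      refine ih _ hker φ.ker ?_ (Du (φ ∘ Q)) (fun x => retractTo φ.ker (f x - Q x)) _ ?_ ?_ ?_ rfl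
      · exact fun r hr hdvd => hK r hr (hdvd.trans (AddSubgroup.card_addSubgroup_dvd_card _))
      · exact ⟨_, Finset.mem_image_of_mem _ (Finset.mem_filter.2 ⟨hQ, rfl⟩)⟩
      · intro R hR
        obtain ⟨P, hP, rfl⟩ := Finset.mem_image.1 hR
        exact retractTo_comp_mem (sub_mem_degreePolys (hT P (Finset.mem_filter.1 hP).1) (hT Q hQ))
          (hmem P hP)
      · intro R hR
        obtain ⟨P, hP, rfl⟩ := Finset.mem_image.1 hR
        obtain ⟨hPT, hPQ⟩ := Finset.mem_filter.1 hP
        refine (hTε P hPT).trans (excess_mono fun x hx => ?_)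
        simp only [Finset.mem_filter, hDu] at hx ⊢
        refine ⟨⟨hx.1, ?_⟩, by simp [hx.2]⟩
        rw [hx.2]
        exact congrFun hPQ x
    have hcount : T.card = ∑ u ∈ U, (T.filter fun P => φ ∘ P = u).card :=
      Finset.card_eq_sum_card_fiberwise fun P hP => Finset.mem_image_of_mem _ hP
    rw [hcount]
    push_cast
    refine (Finset.sum_le_sum hfiber).trans (sum_pow_le_pow (hne.image _) ?_ ?_ ?_ hUcard)
    · exact fun u hu => div_nonneg (hε.le.trans (hUε u hu)) hε.le
    · intro u hu
      exact div_le_div_of_nonneg_right (excess_mono (Finset.filter_subset _ _)) hε.le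
    · intro u hu v hv huv
      rw [← add_div]
      exact div_le_div_of_nonneg_right
        (excess_add_le (g := φ ∘ f) (hUpoly u hu) (hUpoly v hv) huv D) hε.le

/-- A product of `p`-groups with `p ∈ S` is a torsion group whose elements of prime order have
order in `S`. -/
lemma IsProductOfPGroups.torsion {S : Set ℕ} {G : Type u} [AddCommGroup G]
    (h : IsProductOfPGroups S G) :
    IsAddTorsion G ∧ ∀ q : ℕ, q.Prime → ∀ g : G, addOrderOf g = q → q ∈ S := by
  obtain ⟨m, p, H, _, hp, ⟨φ⟩⟩ := h
  have hpow : ∀ i (x : H i), ∃ k, p i ^ k • x = 0 := fun i x => (hp i).2.2 (Multiplicative.ofAdd x)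
  constructor
  · intro g
    choose k hk using fun i => hpow i (φ g i)
    refine isOfFinAddOrder_iff_nsmul_eq_zero.2 ⟨∏ i, p i ^ k i,
      Finset.prod_pos fun i _ => pow_pos (hp i).1.pos _, ?_⟩
    apply φ.injective
    rw [map_nsmul, map_zero]
    refine funext fun i => ?_
    obtain ⟨c, hc⟩ := Finset.dvd_prod_of_mem (fun i => p i ^ k i) (Finset.mem_univ i)
    rw [Pi.smul_apply, hc, mul_comm, mul_smul, hk, smul_zero, Pi.zero_apply]
  · intro q hq g hg
    have hg0 : φ g ≠ 0 := by
      intro h0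
      rw [(map_eq_zero_iff φ φ.injective).1 h0, addOrderOf_zero] at hg
      exact hq.one_lt.ne hg
    obtain ⟨i, hi⟩ := Function.ne_iff.1 hg0
    have hqi : q • φ g i = 0 := by
      rw [← Pi.smul_apply, ← map_nsmul, ← hg, addOrderOf_nsmul_eq_zero, map_zero, Pi.zero_apply]
    obtain ⟨k, hk⟩ := hpow i (φ g i)
    have h1 := addOrderOf_dvd_of_nsmul_eq_zero hqi
    have h2 := addOrderOf_dvd_of_nsmul_eq_zero hk
    rcases (Nat.dvd_prime hq).1 h1 with h3 | h3
    · exact absurd (AddMonoid.addOrderOf_eq_one_iff.1 h3) hi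
    · rw [h3] at h2
      rw [(Nat.prime_dvd_prime_iff_eq hq (hp i).1).1 (hq.dvd_of_dvd_pow h2)]
      exact (hp i).2.1

lemma IsProductOfPGroups.of_prime {S : Set ℕ} {G : Type u} [AddCommGroup G]
    (h : IsProductOfPGroups S G) : IsProductOfPGroups {p | p.Prime ∧ p ∈ S} G := by
  obtain ⟨m, p, H, _, hp, hφ⟩ := h
  exact ⟨m, p, H, inferInstance, fun i => ⟨(hp i).1, ⟨(hp i).1, (hp i).2.1⟩, (hp i).2.2⟩, hφ⟩

open Classical in
/-- The lifting argument for arbitrary products of `p`-groups, by passage to the finite subgroup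
generated by the values of the polynomials. -/
lemma card_le_of_isProductOfPGroups {S : Set ℕ} {ε : ℝ} (hε : 0 < ε) {L : ℕ}
    (hS : ∀ p ∈ S, IsListDecodable (degreePolys d n (ZMod p)) (1 / 2 ^ d - ε) L)
    {G : Type u} [AddCommGroup G] (hG : IsProductOfPGroups S G) (f : (Fin n → Bool) → G)
    (T : Finset ((Fin n → Bool) → G)) (hne : T.Nonempty)
    (hT : ∀ P ∈ T, P ∈ closeList (degreePolys d n G) (1 / 2 ^ d - ε) f) :
    (T.card : ℝ) ≤ (1 / 2 ^ d / ε) ^ Nat.clog 2 L := by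
  obtain ⟨htors, hprime⟩ := hG.torsion
  set V : Finset G := T.biUnion fun P => Finset.univ.image P
  set K := AddSubgroup.closure (V : Set G) with hK
  have hPK : ∀ P ∈ T, ∀ x, P x ∈ K := fun P hP x => AddSubgroup.subset_closure
    (Finset.mem_biUnion.2 ⟨P, hP, Finset.mem_image_of_mem _ (Finset.mem_univ x)⟩)
  have : AddGroup.FG K := (AddGroup.fg_iff_addSubgroup_fg K).2 ⟨V, rfl⟩
  have : Finite K := AddCommGroup.finite_of_fg_isAddTorsion K (htors.addSubgroup K)
  have hinj : Set.InjOn (fun P => retractTo K ∘ P) (T : Set ((Fin n → Bool) → G)) := by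
    intro P hP Q hQ h
    refine funext fun x => ?_
    have h1 := congrArg Subtype.val (congrFun h x)
    simp only [Function.comp_apply] at h1
    rwa [coe_retractTo (hPK P hP x), coe_retractTo (hPK Q hQ x)] at h1
  rw [← Finset.card_image_of_injOn hinj]
  have hexcess : excess d (Finset.univ : Finset (Fin n → Bool)) = 1 / 2 ^ d := by
    simp [excess]
  rw [← hexcess]
  refine card_le_excess_pow hε hS K ?_ Finset.univ (retractTo K ∘ f) _ (hne.image _) ?_ ?_
  · intro q hq hdvd
    have : Fact q.Prime := ⟨hq⟩
    obtain ⟨x, hx⟩ := exists_prime_addOrderOf_dvd_card' q hdvd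
    exact hprime q hq x (by rw [AddSubgroup.addOrderOf_coe, hx])
  · intro Q hQ
    obtain ⟨P, hP, rfl⟩ := Finset.mem_image.1 hQ
    exact retractTo_comp_mem (hT P hP).1 (hPK P hP)
  · intro Q hQ
    obtain ⟨P, hP, rfl⟩ := Finset.mem_image.1 hQ
    refine (le_excess_iff.2 (hT P hP).2).trans (excess_mono fun x hx => ?_)
    simp only [Finset.mem_filter, Finset.mem_univ, true_and] at hx ⊢
    simp [hx]

lemma clog_two_le (L : ℕ) (hL : 0 < L) : (Nat.clog 2 L : ℝ) ≤ 2 / Real.log 2 * Real.log L := by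
  have hlog2 : 0 < Real.log 2 := Real.log_pos one_lt_two
  rcases (Nat.succ_le_of_lt hL).eq_or_lt with rfl | hL2
  · simp
  have hL2' : (2 : ℝ) ≤ L := by exact_mod_cast hL2
  have h1 : Real.log 2 ≤ Real.log L := Real.log_le_log two_pos hL2'
  have h2 : (2 : ℝ) ^ (Nat.clog 2 L - 1) ≤ L := by
    exact_mod_cast (Nat.pow_pred_clog_lt_self one_lt_two hL2).le
  have h3 := Real.log_le_log (by positivity) h2
  rw [Real.log_pow] at h3
  have h4 : ((Nat.clog 2 L : ℕ) : ℝ) ≤ ((Nat.clog 2 L - 1 : ℕ) : ℝ) + 1 := by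
    exact_mod_cast Nat.sub_le_iff_le_add.1 le_rfl
  rw [div_mul_eq_mul_div, le_div_iff₀ hlog2]
  nlinarith

/-- Lifting a list bound from prime fields to products of `p`-groups. -/
lemma isListDecodable_of_isProductOfPGroups {S : Set ℕ} {ε : ℝ} (hε : 0 < ε) {L : ℕ} (hL : 0 < L)
    (hS : ∀ p ∈ S, IsListDecodable (degreePolys d n (ZMod p)) (1 / 2 ^ d - ε) L)
    {G : Type u} [AddCommGroup G] (hG : IsProductOfPGroups S G) :
    IsListDecodable (degreePolys d n G) (1 / 2 ^ d - ε)
      ((L : ℝ) ^ (2 / Real.log 2 * Real.log (1 / ε))) := by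
  refine isListDecodable_of_finset fun f T hT => ?_
  have hL0 : (0 : ℝ) < L := by exact_mod_cast hL
  rcases T.eq_empty_or_nonempty with rfl | hne
  · simpa using Real.rpow_nonneg hL0.le _
  have hε1 : ε ≤ 1 := by
    by_contra! h
    have h1 : (1 : ℝ) / 2 ^ d ≤ 1 := by
      rw [div_le_one (by positivity)]
      exact one_le_pow₀ one_le_two
    obtain ⟨P, hP⟩ := hne
    have := hT P hP
    rw [closeList_eq_empty (by linarith)] at this
    exact this
  have hlog : 0 ≤ Real.log (1 / ε) := Real.log_nonneg (by rwa [le_div_iff₀ hε, one_mul])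
  calc (T.card : ℝ) ≤ (1 / 2 ^ d / ε) ^ Nat.clog 2 L :=
        card_le_of_isProductOfPGroups hε hS hG f T hne hT
    _ ≤ (1 / ε) ^ Nat.clog 2 L := by
        gcongr
        rw [div_le_one (by positivity)]
        exact one_le_pow₀ one_le_two
    _ = Real.exp (Nat.clog 2 L * Real.log (1 / ε)) := by
        rw [Real.exp_nat_mul, Real.exp_log (by positivity)]
    _ ≤ Real.exp (2 / Real.log 2 * Real.log L * Real.log (1 / ε)) := by
        gcongr
        exact clog_two_le L hL
    _ = _ := by
        rw [Real.rpow_def_of_pos hL0]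
        ring_nf

end Lifting

theorem theorem4p3 :
    -- the bound for products of `p`-groups with all `p ≤ p₀`; the factor `C` of `d` is absolute
    (∃ C : ℕ, ∀ d : ℕ, 1 ≤ d → ∀ p₀ : ℕ, ∃ A : ℝ, 0 < A ∧
      ∀ (G : Type u) [AddCommGroup G], IsProductOfPGroups {p | p ≤ p₀} G →
      ∀ (ε : ℝ), 0 < ε → ∀ n : ℕ,
        IsListDecodable (degreePolys d n G) (1 / 2 ^ d - ε) (Real.exp ((A / ε) ^ (C * d)))) ∧
    -- the bound for prime fields
    (∃ C : ℕ, ∀ d : ℕ, 1 ≤ d → ∀ p : ℕ, p.Prime → ∃ A : ℝ, 0 < A ∧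
      ∀ (ε : ℝ), 0 < ε → ∀ n : ℕ,
        IsListDecodable (degreePolys d n (ZMod p)) (1 / 2 ^ d - ε)
          (Real.exp ((A / ε) ^ (C * d)))) ∧
    -- lifting a list bound from prime fields to products of `p`-groups
    (∀ d : ℕ, 1 ≤ d → ∃ C : ℝ, 0 < C ∧
      ∀ (ε : ℝ), 0 < ε → ∀ (n : ℕ) (S : Set ℕ), (∀ p ∈ S, p.Prime) →
      ∀ L : ℕ, 0 < L →
        (∀ p ∈ S, IsListDecodable (degreePolys d n (ZMod p)) (1 / 2 ^ d - ε) L) →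
      ∀ (G : Type u) [AddCommGroup G], IsProductOfPGroups S G →
        IsListDecodable (degreePolys d n G) (1 / 2 ^ d - ε)
          ((L : ℝ) ^ (C * Real.log (1 / ε)))) := by
  have hC : 0 < 2 / Real.log 2 := div_pos two_pos (Real.log_pos one_lt_two)
  have hfield : ∀ (d : ℕ), 1 ≤ d → ∀ p : ℕ, p.Prime → ∀ q : ℕ, p ≤ q → ∀ ε : ℝ, 0 < ε → ∀ n : ℕ,
      IsListDecodable (degreePolys d n (ZMod p)) (1 / 2 ^ d - ε)
        (Real.exp ((18 * (2 + q) / ε) ^ (2 * d))) := by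
    intro d hd p hp q hq ε hε n
    have : NeZero p := ⟨hp.ne_zero⟩
    exact isListDecodable_of_finite hd (by simpa using hq) hε
  refine ⟨⟨3, fun d hd p₀ => ⟨18 * (2 + p₀) * (1 + 2 / Real.log 2), by positivity, ?_⟩⟩,
    ⟨2, fun d hd p hp => ⟨18 * (2 + p), by positivity, fun ε hε n =>
      hfield d hd p hp p le_rfl ε hε n⟩⟩,
    fun d _ => ⟨2 / Real.log 2, hC, fun ε hε n S _ L hL hS G _ hG =>
      isListDecodable_of_isProductOfPGroups hε hL hS hG⟩⟩
  intro G _ hG ε hε n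
  rcases lt_or_ge 1 ε with hε1 | hε1
  · have h1 : (1 : ℝ) / 2 ^ d ≤ 1 := by
      rw [div_le_one (by positivity)]
      exact one_le_pow₀ one_le_two
    intro f
    rw [closeList_eq_empty (by linarith)]
    simpa using Real.exp_nonneg _
  set c := 2 / Real.log 2
  set A : ℝ := 18 * (2 + p₀) with hA
  set B := Real.exp ((A / ε) ^ (2 * d))
  have hB1 : 1 ≤ B := Real.one_le_exp (by positivity)
  have hL : 0 < ⌊B⌋₊ := Nat.floor_pos.2 hB1
  have hS : ∀ p ∈ {p | p.Prime ∧ p ∈ {p | p ≤ p₀}},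
      IsListDecodable (degreePolys d n (ZMod p)) (1 / 2 ^ d - ε) ⌊B⌋₊ := by
    rintro p ⟨hp, hp₀⟩ f
    obtain ⟨h1, h2⟩ := hfield d hd p hp p₀ hp₀ ε hε n f
    exact ⟨h1, Nat.cast_le.2 (Nat.le_floor h2)⟩
  refine (isListDecodable_of_isProductOfPGroups hε hL hS hG.of_prime).mono ?_
  have hlog0 : 0 ≤ Real.log (1 / ε) := Real.log_nonneg (by rwa [le_div_iff₀ hε, one_mul])
  have hlog : Real.log (1 / ε) ≤ 1 / ε := Real.log_le_self (by positivity)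
  have hA1 : 1 ≤ A := by
    have : (0 : ℝ) ≤ p₀ := Nat.cast_nonneg _
    linarith
  calc (⌊B⌋₊ : ℝ) ^ (c * Real.log (1 / ε)) ≤ B ^ (c * Real.log (1 / ε)) :=
        Real.rpow_le_rpow (Nat.cast_nonneg _) (Nat.floor_le (by positivity)) (by positivity)
    _ = Real.exp ((A / ε) ^ (2 * d) * (c * Real.log (1 / ε))) := (Real.exp_mul _ _).symm
    _ ≤ Real.exp ((A * (1 + c) / ε) ^ (3 * d)) := by
        refine Real.exp_le_exp.2 ?_
        have h1 : c * Real.log (1 / ε) ≤ (A * (1 + c) / ε) ^ d := by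
          have h2 : c * Real.log (1 / ε) ≤ c * (1 / ε) := by gcongr
          have h3 : c * (1 / ε) ≤ A * (1 + c) * (1 / ε) := by
            gcongr
            nlinarith
          have h4 : 1 ≤ A * (1 + c) / ε := by
            rw [le_div_iff₀ hε]
            nlinarith
          have h5 := le_self_pow₀ h4 (show d ≠ 0 by omega)
          calc _ ≤ A * (1 + c) * (1 / ε) := h2.trans h3
            _ = A * (1 + c) / ε := by ring
            _ ≤ _ := h5
        have h6 : (A / ε) ^ (2 * d) ≤ (A * (1 + c) / ε) ^ (2 * d) := by
          gcongr
          nlinarith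
        calc _ ≤ (A * (1 + c) / ε) ^ (2 * d) * (A * (1 + c) / ε) ^ d := by gcongr
          _ = _ := by rw [← pow_add]; congr 1; ring
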